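/- Let $\mathscr V$ be a locally small symmetric monoidal closed category, and let $\mathbf S \dashv \mathbf T : \mathbf C \to \mathbf B$ be a $\mathscr V$-adjunction between $\mathscr V$-categories (i.e. $\mathscr V$-functors $\mathbf S:\mathbf B\to\mathbf C$, $\mathbf T:\mathbf C\to\mathbf B$ with $\mathscr V$-natural unit and counit satisfying the triangle identities). Write $S$ for the ordinary functor underlying $\mathbf S$. In a $\mathscr V$-category $\mathbf A$, a morphism $m:B_1\to B_2$ is a $\mathscr V$-mono if $\mathbf A(A,m)$ is a monomorphism in $\mathscr V$ for every object $A$; a morphism $e:A_1\to A_2$ is a $\mathscr V$-epi if $\mathbf A(e,A)$ is a monomorphism in $\mathscr V$ for every $A$; and $e\downarrow_{\mathscr V} m$ means that the square with sides $\mathbf A(A_2,m)$, $\mathbf A(e,B_1)$, $\mathbf A(e,B_2)$, $\mathbf A(A_1,m)$ is a pullback in $\mathscr V$. A $\mathscr V$-strong mono is a $\mathscr V$-mono $m$ such that $e\downarrow_{\mathscr V} m$ for every $\mathscr V$-epi $e$. A pair $(\mathcal E,\mathcal M)$ of classes of morphisms is a $\mathscr V$-factorization system if $\mathcal M=\{m\mid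 e\downarrow_{\mathscr V} m\ \ \forall e\in\mathcal E\}$, $\mathcal E=\{e\mid e\downarrow_{\mathscr V} m\ \ \forall m\in\mathcal M\}$, and every morphism is a member of $\mathcal E$ followed by a member of $\mathcal M$; it is $\mathscr V$-proper if every member of $\mathcal E$ is a $\mathscr V$-epi and every member of $\mathcal M$ is a $\mathscr V$-mono. A $\mathscr V$-limit is a limit in the underlying category of $\mathbf A$ that is preserved by every functor $\mathbf A(A,-)$ into $\mathscr V$. Let $\mathcal E$ and $\mathcal M$ be the classes of all $\mathscr V$-epis and of all $\mathscr V$-strong monos in $\mathbf B$. Suppose that $(\mathcal E,\mathcal M)$ is a $\mathscr V$-proper $\mathscr V$-factorization system on $\mathbf B$, and that $\mathbf B$ is cotensored and has $\mathscr V$-equalizers, $\mathscr V$-pullbacks of $\mathcal M$-morphisms along arbitrary morphisms, and $\mathscr V$-fiber-products of arbitrary (class-indexed) families of $\mathcal M$-morphisms with common codomain. Then there are a full sub-$\mathscr V$-category $\mathbf B''$ of $\mathbf B$, with inclusion $\mathbf J:\mathbf B''\hookrightarrow\mathbf B$, and $\mathscr V$-adjunctions $\mathbf K\dashv\mathbf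 J:\mathbf B''\hookrightarrow\mathbf B$ and $\mathbf S''\dashv\mathbf T'':\mathbf C\to\mathbf B''$, the latter with unit $\eta''$, such that: 1. $\mathbf J\mathbf T''=\mathbf T$ and $\mathbf S''=\mathbf S\mathbf J$; 2. $\mathbf S''$ is conservative, i.e. reflects isomorphisms; 3. each component of $\eta''$, regarded as a morphism of $\mathbf B$, lies in $\mathcal M$; 4. $\mathbf B''=\mathbf B_{\Sigma_S}$, that is, the objects of $\mathbf B''$ are exactly those objects $B$ of $\mathbf B$ for which $\mathbf B(f,B):\mathbf B(A_2,B)\to\mathbf B(A_1,B)$ is an isomorphism in $\mathscr V$ for every morphism $f:A_1\to A_2$ of $\mathbf B$ such that $Sf$ is an isomorphism. -/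

import Mathlib

open CategoryTheory MonoidalCategory Limits

universe v u v₁ v₂ u₁ u₂

namespace EnrichedAdjFactorization

variable (V : Type u) [Category.{v} V] [MonoidalCategory V]

section Functors

variable {V}
variable {B : Type u₁} [Category.{v₁} B] [EnrichedOrdinaryCategory V B]
variable {C : Type u₂} [Category.{v₂} C] [EnrichedOrdinaryCategory V C]

/-- The ordinary functor underlying a `V`-functor: a morphism `f`, regarded as a `V`-morphism
`𝟙_ V ⟶ (X ⟶[V] Y)`, is sent to the composite with `F.map X Y`. -/
def underlying (F : EnrichedFunctor V B C) : B ⥤ C where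
  obj X := F.obj X
  map {X Y} f := (eHomEquiv V).symm (eHomEquiv V f ≫ F.map X Y)
  map_id X := by
    apply (eHomEquiv V).injective
    rw [Equiv.apply_symm_apply, eHomEquiv_id, eHomEquiv_id, F.map_id]
  map_comp {X Y Z} f g := by
    apply (eHomEquiv V).injective
    rw [Equiv.apply_symm_apply, eHomEquiv_comp, eHomEquiv_comp, Equiv.apply_symm_apply,
      Equiv.apply_symm_apply, Category.assoc, Category.assoc, F.map_comp,
      ← MonoidalCategory.tensorHom_comp_tensorHom_assoc]

/-- A `V`-natural transformation: components in the underlying category, with naturality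
expressed by an equality of morphisms `(X ⟶[V] Y) ⟶ (F.obj X ⟶[V] G.obj Y)` in `V`. -/
structure VNatTrans (F G : EnrichedFunctor V B C) where
  /-- The components. -/
  app (X : B) : F.obj X ⟶ G.obj X
  /-- `V`-naturality. -/
  naturality (X Y : B) :
    F.map X Y ≫ eHomWhiskerLeft V (F.obj X) (app Y) =
      G.map X Y ≫ eHomWhiskerRight V (app X) (G.obj Y)

/-- A `V`-adjunction `F ⊣ G`, given by `V`-natural unit and counit satisfying the triangle
identities. -/
structure VAdjunction (F : EnrichedFunctor V B C) (G : EnrichedFunctor V C B) where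
  /-- The unit. -/
  unit : VNatTrans (EnrichedFunctor.id V B) (F.comp V G)
  /-- The counit. -/
  counit : VNatTrans (G.comp V F) (EnrichedFunctor.id V C)
  /-- First triangle identity. -/
  left_triangle (X : B) :
    (underlying F).map (unit.app X) ≫ counit.app (F.obj X) = 𝟙 (F.obj X)
  /-- Second triangle identity. -/
  right_triangle (Y : C) :
    unit.app (G.obj Y) ≫ (underlying G).map (counit.app Y) = 𝟙 (G.obj Y)

/-- The inclusion of a full sub-`V`-category. -/
def fullInclusion (P : ObjectProperty B) : EnrichedFunctor V P.FullSubcategory B where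
  obj X := X.obj
  map X Y := 𝟙 (X.obj ⟶[V] Y.obj)
  map_id X := Category.comp_id (eId V X.obj)
  map_comp X Y Z :=
    (Category.comp_id (eComp V X.obj Y.obj Z.obj)).trans <|
      (Category.id_comp (eComp V X.obj Y.obj Z.obj)).symm.trans <|
        congrArg (· ≫ eComp V X.obj Y.obj Z.obj)
          (MonoidalCategory.id_tensorHom_id (X.obj ⟶[V] Y.obj) (Y.obj ⟶[V] Z.obj)).symm

/-- The class of all morphisms inverted by the functor underlying `F`. -/
def inverted (F : EnrichedFunctor V B C) : MorphismProperty B :=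
  fun _ _ f => IsIso ((underlying F).map f)

end Functors

section Morphisms

variable {B : Type u₁} [Category.{v₁} B] [EnrichedOrdinaryCategory V B]

variable (B) in
/-- `V`-monos: the maps `(A ⟶[V] X) ⟶ (A ⟶[V] Y)` given by composition with `m` are monos. -/
def vMono : MorphismProperty B :=
  fun _ _ m => ∀ A : B, Mono (eHomWhiskerLeft V A m)

variable (B) in
/-- `V`-epis: the maps `(Y ⟶[V] A) ⟶ (X ⟶[V] A)` given by composition with `e` are monos. -/
def vEpi : MorphismProperty B :=
  fun _ _ e => ∀ A : B, Mono (eHomWhiskerRight V e A)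

/-- `V`-orthogonality of a morphism `e` to a morphism `m`. -/
def VOrthogonal {A₁ A₂ B₁ B₂ : B} (e : A₁ ⟶ A₂) (m : B₁ ⟶ B₂) : Prop :=
  IsPullback (eHomWhiskerLeft V A₂ m) (eHomWhiskerRight V e B₁)
    (eHomWhiskerRight V e B₂) (eHomWhiskerLeft V A₁ m)

/-- The class of all `m` such that every `e` in `E` is `V`-orthogonal to `m`. -/
def vRightOrth (E : MorphismProperty B) : MorphismProperty B :=
  fun _ _ m => ∀ ⦃A₁ A₂ : B⦄ (e : A₁ ⟶ A₂), E e → VOrthogonal V e m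

/-- The class of all `e` that are `V`-orthogonal to every `m` in `M`. -/
def vLeftOrth (M : MorphismProperty B) : MorphismProperty B :=
  fun _ _ e => ∀ ⦃B₁ B₂ : B⦄ (m : B₁ ⟶ B₂), M m → VOrthogonal V e m

variable (B) in
/-- `V`-strong monos: the `V`-monos to which every `V`-epi is `V`-orthogonal. -/
def vStrongMono : MorphismProperty B :=
  vRightOrth V (vEpi V B) ⊓ vMono V B

/-- `V`-prefactorization systems. -/
structure IsVPrefactorizationSystem (E M : MorphismProperty B) : Prop where
  right_eq : vRightOrth V E = M
  left_eq : vLeftOrth V M = E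

/-- `V`-factorization systems. -/
structure IsVFactorizationSystem (E M : MorphismProperty B) : Prop
    extends IsVPrefactorizationSystem V E M where
  exists_factorization {X Y : B} (f : X ⟶ Y) :
    ∃ (Z : B) (e : X ⟶ Z) (m : Z ⟶ Y), E e ∧ M m ∧ e ≫ m = f

/-- `V`-properness: members of `E` are `V`-epis and members of `M` are `V`-monos. -/
structure IsVProper (E M : MorphismProperty B) : Prop where
  le_epi : E ≤ vEpi V B
  le_mono : M ≤ vMono V B

/-- The objects `X` to which every morphism in `W` is `V`-orthogonal, i.e. such that
`(A₂ ⟶[V] X) ⟶ (A₁ ⟶[V] X)` is an isomorphism for every `f : A₁ ⟶ A₂` in `W`. -/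
def vOrthogonalObjects (W : MorphismProperty B) : ObjectProperty B :=
  fun X => ∀ ⦃A₁ A₂ : B⦄ (f : A₁ ⟶ A₂), W f → IsIso (eHomWhiskerRight V f X)

end Morphisms

section Limits

variable (B : Type u₁) [Category.{v₁} B] [EnrichedOrdinaryCategory V B]

/-- Existence of `V`-equalizers. -/
def HasVEqualizers : Prop :=
  ∀ ⦃X Y : B⦄ (f g : X ⟶ Y), Enriched.HasConicalLimit V (parallelPair f g)

variable {B} in
/-- Existence of `V`-pullbacks of morphisms in `M` along arbitrary morphisms. -/
def HasVPullbacksOf (M : MorphismProperty B) : Prop :=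
  ∀ ⦃X Y Z : B⦄ (f : X ⟶ Z) (m : Y ⟶ Z), M m → Enriched.HasConicalPullback V f m

variable {B} in
/-- Existence of `V`-fiber-products of arbitrary (class-indexed, i.e. of the size of the class
of all morphisms of `B`) families of morphisms in `M` with common codomain. -/
def HasVFiberProductsOf (M : MorphismProperty B) : Prop :=
  ∀ (A : B) (ι : Type (max u₁ v₁)) (X : ι → B) (m : ∀ i, X i ⟶ A), (∀ i, M (m i)) →
    Enriched.HasConicalLimit V (WidePullbackShape.wideCospan A X m)

variable [SymmetricCategory V] [MonoidalClosed V]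

variable {V B} in
/-- The comparison `(A ⟶[V] P) ⟶ [W, (A ⟶[V] X)]` in `V` induced by `ξ : W ⟶ (P ⟶[V] X)`. -/
def cotensorComparison {W : V} {X P : B} (ξ : W ⟶ (P ⟶[V] X)) (A : B) :
    (A ⟶[V] P) ⟶ (ihom W).obj (A ⟶[V] X) :=
  MonoidalClosed.curry
    ((β_ W (A ⟶[V] P)).hom ≫ (A ⟶[V] P) ◁ ξ ≫ eComp V A P X)

/-- `B` is cotensored: for all `W` in `V` and `X` in `B` there is an object `P = [W, X]` with a
universal `ξ : W ⟶ (P ⟶[V] X)`, inducing isomorphisms `(A ⟶[V] P) ≅ [W, (A ⟶[V] X)]`. -/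
def IsCotensored : Prop :=
  ∀ (W : V) (X : B), ∃ (P : B) (ξ : W ⟶ (P ⟶[V] X)), ∀ A : B, IsIso (cotensorComparison ξ A)

end Limits

end EnrichedAdjFactorization

open CategoryTheory MonoidalCategory Limits

namespace EnrichedAdjFactorization

/-! ### Hom objects against morphisms of the underlying categories. -/

section Functors

variable {V : Type u} [Category.{v} V] [MonoidalCategory V]
variable {B : Type u₁} [Category.{v₁} B] [EnrichedOrdinaryCategory V B]
variable {C : Type u₂} [Category.{v₂} C] [EnrichedOrdinaryCategory V C]

/-! Call an object orthogonal if it lies in `vOrthogonalObjects V (inverted S)`. Every `T Y` is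
orthogonal, since transposition identifies `B(f, T Y)` with `C(S f, Y)`. The key criterion is
`isIso_homMap`: if `u ≫ m = η` and `u` is right cancellable against maps into objects `T Y`, then `S
u` is split mono by a triangle identity and epi by transposition, hence invertible.

The criterion serves twice. In `exists_reflection`, `A` is reflected into the intersection `R` of
suitable subobjects of `T (S A)` through which the unit factors; an equalizer of two maps `R ⟶ T Y`
that agree on `A` is again such a subobject, so minimality of `R` forces the maps to be equal. Thus
`S` inverts `u : A ⟶ R`, and `B(u, Y)` is invertible for every orthogonal `Y`. In `vStrongMono_η`,
the `V`-epi factor of the unit at an orthogonal object is inverted by `S`, so it is a split mono and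
therefore an isomorphism.

Conservativity (`isIso_of_inverted`) is formal: precomposition with an inverted morphism between
orthogonal objects is bijective on maps into either of them. -/

lemma eHomEquiv_comp_eHomWhiskerLeft {X Y Z : B} (f : X ⟶ Y) (g : Y ⟶ Z) :
    eHomEquiv V f ≫ eHomWhiskerLeft V X g = eHomEquiv V (f ≫ g) := by
  rw [eHomEquiv_comp, eHomWhiskerLeft, rightUnitor_inv_naturality_assoc,
    MonoidalCategory.tensorHom_def,
    Category.assoc, unitors_inv_equal]

lemma eHomEquiv_comp_eHomWhiskerRight {X Y Z : B} (f : X ⟶ Y) (g : Y ⟶ Z) :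
    eHomEquiv V g ≫ eHomWhiskerRight V f Z = eHomEquiv V (f ≫ g) := by
  rw [eHomEquiv_comp, eHomWhiskerRight, leftUnitor_inv_naturality_assoc,
    MonoidalCategory.tensorHom_def',
    Category.assoc]

/-- Enriched composition is dinatural in the middle variable. -/
lemma eHomWhiskerLeft_whiskerRight_eComp (X Z : B) {Y Y' : B} (f : Y ⟶ Y') :
    eHomWhiskerLeft V X f ▷ (Y' ⟶[V] Z) ≫ eComp V X Y' Z =
      (X ⟶[V] Y) ◁ eHomWhiskerRight V f Z ≫ eComp V X Y Z := by
  simp [eHomWhiskerLeft, eHomWhiskerRight]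

lemma vMono.mono {X Y : B} {m : X ⟶ Y} (hm : vMono V B m) : Mono m where
  right_cancellation {Z} g h w := by
    have := hm Z
    apply (eHomEquiv V).injective
    rw [← cancel_mono (eHomWhiskerLeft V Z m), eHomEquiv_comp_eHomWhiskerLeft,
      eHomEquiv_comp_eHomWhiskerLeft, w]

lemma vEpi.epi {X Y : B} {e : X ⟶ Y} (he : vEpi V B e) : Epi e where
  left_cancellation {Z} g h w := by
    have := he Z
    apply (eHomEquiv V).injective
    rw [← cancel_mono (eHomWhiskerRight V e Z), eHomEquiv_comp_eHomWhiskerRight,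
      eHomEquiv_comp_eHomWhiskerRight, w]

lemma existsUnique_comp_eq {X Y Z : B} (f : X ⟶ Y) [IsIso (eHomWhiskerRight V f Z)]
    (g : X ⟶ Z) : ∃! h : Y ⟶ Z, f ≫ h = g := by
  refine ⟨(eHomEquiv V).symm (eHomEquiv V g ≫ inv (eHomWhiskerRight V f Z)), ?_, ?_⟩
  · apply (eHomEquiv V).injective
    rw [← eHomEquiv_comp_eHomWhiskerRight, Equiv.apply_symm_apply, Category.assoc,
      IsIso.inv_hom_id, Category.comp_id]
  · rintro h rfl
    rw [← eHomEquiv_comp_eHomWhiskerRight, Category.assoc, IsIso.hom_inv_id, Category.comp_id,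
      Equiv.symm_apply_apply]

instance isIso_eHomWhiskerLeft (X : B) {Y Z : B} (f : Y ⟶ Z) [IsIso f] :
    IsIso (eHomWhiskerLeft V X f) :=
  ⟨eHomWhiskerLeft V X (inv f), by simp [← eHomWhiskerLeft_comp],
    by simp [← eHomWhiskerLeft_comp]⟩

instance isIso_eHomWhiskerRight {X Y : B} (f : X ⟶ Y) [IsIso f] (Z : B) :
    IsIso (eHomWhiskerRight V f Z) :=
  ⟨eHomWhiskerRight V (inv f) Z, by simp [← eHomWhiskerRight_comp],
    by simp [← eHomWhiskerRight_comp]⟩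

/-- The action of a `V`-functor on morphisms of the underlying categories. -/
def homMap (F : EnrichedFunctor V B C) {X Y : B} (f : X ⟶ Y) : F.obj X ⟶ F.obj Y :=
  (underlying F).map f

lemma homMap_comp (F : EnrichedFunctor V B C) {X Y Z : B} (f : X ⟶ Y) (g : Y ⟶ Z) :
    homMap F (f ≫ g) = homMap F f ≫ homMap F g :=
  (underlying F).map_comp f g

lemma eHomEquiv_homMap (F : EnrichedFunctor V B C) {X Y : B} (f : X ⟶ Y) :
    eHomEquiv V (homMap F f) = eHomEquiv V f ≫ F.map X Y :=
  Equiv.apply_symm_apply _ _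

lemma eHomWhiskerLeft_map (F : EnrichedFunctor V B C) (X : B) {Y Z : B} (g : Y ⟶ Z) :
    eHomWhiskerLeft V X g ≫ F.map X Z =
      F.map X Y ≫ eHomWhiskerLeft V (F.obj X) (homMap F g) := by
  simp only [eHomWhiskerLeft, Category.assoc, F.map_comp, MonoidalCategory.tensorHom_def',
    rightUnitor_inv_naturality_assoc, MonoidalCategory.whiskerLeft_comp_assoc,
    eHomEquiv_homMap, whisker_exchange_assoc]

lemma eHomWhiskerRight_map (F : EnrichedFunctor V B C) {X Y : B} (f : X ⟶ Y) (Z : B) :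
    eHomWhiskerRight V f Z ≫ F.map X Z =
      F.map Y Z ≫ eHomWhiskerRight V (homMap F f) (F.obj Z) := by
  simp only [eHomWhiskerRight, Category.assoc, F.map_comp, MonoidalCategory.tensorHom_def,
    leftUnitor_inv_naturality_assoc, comp_whiskerRight_assoc, eHomEquiv_homMap,
    ← whisker_exchange_assoc]

/-! ### Transposition, and a criterion for the left adjoint to invert a morphism. -/

namespace VAdjunction

variable {S : EnrichedFunctor V B C} {T : EnrichedFunctor V C B} (adj : VAdjunction S T)

/-- Components of the unit. -/
def η (X : B) : X ⟶ T.obj (S.obj X) := adj.unit.app X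

/-- Components of the counit. -/
def ε (Y : C) : S.obj (T.obj Y) ⟶ Y := adj.counit.app Y

lemma eHomWhiskerLeft_η (X Y : B) :
    eHomWhiskerLeft V X (adj.η Y) =
      S.map X Y ≫ T.map (S.obj X) (S.obj Y) ≫
        eHomWhiskerRight V (adj.η X) (T.obj (S.obj Y)) :=
  (Category.id_comp _).symm.trans ((adj.unit.naturality X Y).trans (Category.assoc _ _ _))

lemma map_map_eHomWhiskerLeft_ε (X Y : C) :
    T.map X Y ≫ S.map (T.obj X) (T.obj Y) ≫ eHomWhiskerLeft V (S.obj (T.obj X)) (adj.ε Y) =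
      eHomWhiskerRight V (adj.ε X) Y :=
  (Category.assoc _ _ _).symm.trans ((adj.counit.naturality X Y).trans (Category.id_comp _))

lemma homMap_η_ε (X : B) : homMap S (adj.η X) ≫ adj.ε (S.obj X) = 𝟙 (S.obj X) :=
  adj.left_triangle X

lemma η_homMap_ε (Y : C) : adj.η (T.obj Y) ≫ homMap T (adj.ε Y) = 𝟙 (T.obj Y) :=
  adj.right_triangle Y

lemma η_naturality {X Y : B} (f : X ⟶ Y) :
    f ≫ adj.η Y = adj.η X ≫ homMap T (homMap S f) := by
  apply (eHomEquiv V).injective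
  rw [← eHomEquiv_comp_eHomWhiskerLeft, eHomWhiskerLeft_η,
    ← eHomEquiv_comp_eHomWhiskerRight, eHomEquiv_homMap, eHomEquiv_homMap, Category.assoc,
    Category.assoc]

lemma ε_naturality {X Y : C} (f : X ⟶ Y) :
    homMap S (homMap T f) ≫ adj.ε Y = adj.ε X ≫ f := by
  apply (eHomEquiv V).injective
  rw [← eHomEquiv_comp_eHomWhiskerLeft, ← eHomEquiv_comp_eHomWhiskerRight,
    ← map_map_eHomWhiskerLeft_ε, eHomEquiv_homMap, eHomEquiv_homMap, Category.assoc,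
    Category.assoc]

/-- Transposition `(S A ⟶[V] Y) ≅ (A ⟶[V] T Y)`. -/
def homIso (A : B) (Y : C) : (S.obj A ⟶[V] Y) ≅ (A ⟶[V] T.obj Y) where
  hom := T.map (S.obj A) Y ≫ eHomWhiskerRight V (adj.η A) (T.obj Y)
  inv := S.map A (T.obj Y) ≫ eHomWhiskerLeft V (S.obj A) (adj.ε Y)
  hom_inv_id := by
    rw [Category.assoc, reassoc_of% eHomWhiskerRight_map (V := V), ← eHom_whisker_exchange,
      ← Category.assoc (S.map _ _), ← Category.assoc, map_map_eHomWhiskerLeft_ε,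
      ← eHomWhiskerRight_comp, homMap_η_ε, eHomWhiskerRight_id]
  inv_hom_id := by
    rw [Category.assoc, reassoc_of% eHomWhiskerLeft_map (V := V), eHom_whisker_exchange,
      ← Category.assoc (T.map _ _), ← Category.assoc, ← eHomWhiskerLeft_η,
      ← eHomWhiskerLeft_comp, η_homMap_ε, eHomWhiskerLeft_id]

/-- Naturality of transposition in the `B` variable; it transfers invertibility of `S f` to `B(f, T
Y)`. -/
lemma eHomWhiskerRight_homIso_hom {A₁ A₂ : B} (f : A₁ ⟶ A₂) (Y : C) :
    eHomWhiskerRight V (homMap S f) Y ≫ (adj.homIso A₁ Y).hom =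
      (adj.homIso A₂ Y).hom ≫ eHomWhiskerRight V f (T.obj Y) := by
  simp only [homIso, reassoc_of% eHomWhiskerRight_map (V := V), Category.assoc,
    ← eHomWhiskerRight_comp,
    η_naturality]

/-- The right adjoint takes values in the objects orthogonal to the morphisms inverted by the
left adjoint. -/
lemma obj_mem_vOrthogonalObjects (adj : VAdjunction S T) (Y : C) :
    vOrthogonalObjects V (inverted S) (T.obj Y) := by
  intro A₁ A₂ f hf
  have : IsIso (homMap S f) := hf
  rw [← (Iso.inv_comp_eq _).2 (adj.eHomWhiskerRight_homIso_hom f Y)]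
  infer_instance

/-- The left adjoint sends a morphism to an epi as soon as it is right cancellable with respect
to morphisms into the image of the right adjoint. -/
lemma epi_homMap (adj : VAdjunction S T) {X Z : B} (u : X ⟶ Z)
    (hu : ∀ (Y : C) (g h : Z ⟶ T.obj Y), u ≫ g = u ≫ h → g = h) : Epi (homMap S u) where
  left_cancellation {Y} g h w := by
    -- Transposes of `g` and `h`: they agree after `u` by naturality of the unit, so `hu` applies.
    have key : adj.η Z ≫ homMap T g = adj.η Z ≫ homMap T h := by
      apply hu
      rw [reassoc_of% adj.η_naturality, reassoc_of% adj.η_naturality, ← homMap_comp,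
        ← homMap_comp, w]
    have aux (g : S.obj Z ⟶ Y) : homMap S (adj.η Z ≫ homMap T g) ≫ adj.ε Y = g := by
      rw [homMap_comp, Category.assoc, ε_naturality, reassoc_of% adj.homMap_η_ε]
    rw [← aux g, key, aux h]

/-- If the unit at `X` factors through `u`, and `u` is right cancellable with respect to
morphisms into the image of the right adjoint, then the left adjoint inverts `u`. -/
lemma isIso_homMap (adj : VAdjunction S T) {X Z : B} (u : X ⟶ Z)
    (m : Z ⟶ T.obj (S.obj X)) (h : u ≫ m = adj.η X)
    (hu : ∀ (Y : C) (g h : Z ⟶ T.obj Y), u ≫ g = u ≫ h → g = h) : IsIso (homMap S u) := by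
  have := adj.epi_homMap u hu
  have : IsSplitMono (homMap S u) := ⟨⟨{
    retraction := homMap S m ≫ adj.ε (S.obj X)
    id := by rw [← reassoc_of% homMap_comp (V := V), h, homMap_η_ε] }⟩⟩
  exact isIso_of_epi_of_isSplitMono _

end VAdjunction

/-! ### Restriction to full sub-`V`-categories. -/

/-- The corestriction of a `V`-functor to a full sub-`V`-category. -/
def liftFull (P : ObjectProperty B) (T : EnrichedFunctor V C B) (h : ∀ Y, P (T.obj Y)) :
    EnrichedFunctor V C P.FullSubcategory where
  obj Y := ⟨T.obj Y, h Y⟩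
  map X Y := T.map X Y
  map_id X := T.map_id X
  map_comp X Y Z := T.map_comp X Y Z

lemma liftFull_comp_fullInclusion (P : ObjectProperty B) (T : EnrichedFunctor V C B)
    (h : ∀ Y, P (T.obj Y)) : (liftFull P T h).comp V (fullInclusion P) = T := by
  obtain ⟨obj, map, _, _⟩ := T
  simp only [EnrichedFunctor.comp, fullInclusion, liftFull]
  congr 1
  funext X Y
  exact Category.comp_id _

lemma homMap_fullInclusion (P : ObjectProperty B) {X Y : P.FullSubcategory} (f : X ⟶ Y) :
    homMap (fullInclusion (V := V) P) f = f.hom := by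
  apply (eHomEquiv V).injective
  rw [eHomEquiv_homMap]
  exact Category.comp_id _

lemma homMap_fullInclusion_comp (P : ObjectProperty B) (S : EnrichedFunctor V B C)
    {X Y : P.FullSubcategory} (f : X ⟶ Y) :
    homMap ((fullInclusion P).comp V S) f = homMap S f.hom := by
  apply (eHomEquiv V).injective
  refine (eHomEquiv_homMap _ f).trans (Eq.trans ?_ (eHomEquiv_homMap S f.hom).symm)
  exact congrArg (eHomEquiv V f.hom ≫ ·) (Category.id_comp (S.map X.obj Y.obj))

/-- Restriction of an adjunction to a full sub-`V`-category containing the image of the right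
adjoint. -/
def VAdjunction.restrict {S : EnrichedFunctor V B C} {T : EnrichedFunctor V C B}
    (adj : VAdjunction S T) (P : ObjectProperty B) (h : ∀ Y, P (T.obj Y)) :
    VAdjunction ((fullInclusion P).comp V S) (liftFull P T h) where
  unit :=
    { app X := ObjectProperty.homMk (adj.η X.obj)
      naturality X Y := by
        -- Hom objects of the full sub-`V`-category are by definition those of `B`, so only inserted
        -- identities have to be removed.
        have h := adj.unit.naturality X.obj Y.obj
        refine h.trans (congrArg (· ≫ _) ?_)
        exact congrArg (· ≫ T.map _ _) (Category.id_comp (S.map _ _)).symm }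
  counit :=
    { app Y := adj.ε Y
      naturality X Y := by
        refine Eq.trans (congrArg (· ≫ _) ?_) (adj.counit.naturality X Y)
        exact congrArg (T.map _ _ ≫ ·) (Category.id_comp (S.map _ _)) }
  left_triangle X :=
    (congrArg (· ≫ adj.ε (S.obj X.obj)) (homMap_fullInclusion_comp P S _)).trans
      (adj.homMap_η_ε X.obj)
  right_triangle Y := ObjectProperty.hom_ext _ (adj.η_homMap_ε Y)

/-! ### Reflections from orthogonality. -/

/-- Morphisms `u X : X ⟶ obj X`, orthogonal to all objects in `P`, with `obj X` in `P`. -/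
structure Reflection (V : Type u) [Category.{v} V] [MonoidalCategory V]
    [EnrichedOrdinaryCategory V B] (P : ObjectProperty B) where
  /-- The reflections. -/
  obj (X : B) : B
  prop (X : B) : P (obj X)
  /-- The units. -/
  u (X : B) : X ⟶ obj X
  isIso (X Y : B) (hY : P Y) : IsIso (eHomWhiskerRight V (u X) Y)

namespace Reflection

variable {P : ObjectProperty B} (R : Reflection V P)

instance (X Y : B) : IsIso (eHomWhiskerRight V (R.u X) (R.obj Y)) := R.isIso X _ (R.prop Y)

/-- The action of the reflector on hom objects. -/
noncomputable def map (X Y : B) : (X ⟶[V] Y) ⟶ (R.obj X ⟶[V] R.obj Y) :=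
  eHomWhiskerLeft V X (R.u Y) ≫ inv (eHomWhiskerRight V (R.u X) (R.obj Y))

lemma map_eHomWhiskerRight (X Y : B) :
    R.map X Y ≫ eHomWhiskerRight V (R.u X) (R.obj Y) = eHomWhiskerLeft V X (R.u Y) := by
  simp [map]

lemma map_id (X : B) : eId V X ≫ R.map X X = eId V (R.obj X) := by
  rw [← cancel_mono (eHomWhiskerRight V (R.u X) (R.obj X)), Category.assoc, map_eHomWhiskerRight,
    ← eHomEquiv_id, ← eHomEquiv_id, eHomEquiv_comp_eHomWhiskerLeft,
    eHomEquiv_comp_eHomWhiskerRight, Category.id_comp, Category.comp_id]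

/-- Test after the invertible map `B(u_X, R Z)`; dinaturality of composition then moves `u_Y` from
one factor to the other. -/
lemma map_comp (X Y Z : B) :
    eComp V X Y Z ≫ R.map X Z =
      (R.map X Y ⊗ₘ R.map Y Z) ≫ eComp V (R.obj X) (R.obj Y) (R.obj Z) := by
  rw [← cancel_mono (eHomWhiskerRight V (R.u X) (R.obj Z)), Category.assoc, map_eHomWhiskerRight,
    Category.assoc, eComp_eHomWhiskerRight, eComp_eHomWhiskerLeft,
    MonoidalCategory.tensorHom_def', Category.assoc, ← comp_whiskerRight_assoc,
    map_eHomWhiskerRight, eHomWhiskerLeft_whiskerRight_eComp,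
    ← MonoidalCategory.whiskerLeft_comp_assoc, map_eHomWhiskerRight]

/-- The reflector. -/
noncomputable def functor : EnrichedFunctor V B P.FullSubcategory where
  obj X := ⟨R.obj X, R.prop X⟩
  map := R.map
  map_id := R.map_id
  map_comp := R.map_comp

/-- Orthogonality of `Y` gives a retraction `r` of the unit; `r ≫ u` and the identity agree after
`u`, so orthogonality of `R Y` makes them equal. -/
lemma isIso_u (R : Reflection V P) {Y : B} (hY : P Y) : IsIso (R.u Y) := by
  have := R.isIso Y Y hY
  obtain ⟨r, hr, -⟩ := existsUnique_comp_eq (V := V) (R.u Y) (𝟙 Y)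
  refine ⟨r, hr, (existsUnique_comp_eq (V := V) (Z := R.obj Y) (R.u Y) (R.u Y)).unique ?_ ?_⟩
  · rw [reassoc_of% hr]
  · rw [Category.comp_id]

/-- The action of the reflector on morphisms. -/
noncomputable def mapHom {X Y : B} (f : X ⟶ Y) : R.obj X ⟶ R.obj Y := (homMap R.functor f).hom

lemma eHomEquiv_mapHom {X Y : B} (f : X ⟶ Y) :
    eHomEquiv V (R.mapHom f) = eHomEquiv V f ≫ R.map X Y :=
  eHomEquiv_homMap R.functor f

lemma u_naturality {X Y : B} (f : X ⟶ Y) : R.u X ≫ R.mapHom f = f ≫ R.u Y := by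
  apply (eHomEquiv V).injective
  rw [← eHomEquiv_comp_eHomWhiskerRight, ← eHomEquiv_comp_eHomWhiskerLeft, eHomEquiv_mapHom,
    Category.assoc, map_eHomWhiskerRight]

lemma mapHom_u (X : B) : R.mapHom (R.u X) = R.u (R.obj X) :=
  (existsUnique_comp_eq (V := V) (Z := R.obj (R.obj X)) (R.u X) (R.u X ≫ R.u (R.obj X))).unique
    (R.u_naturality (R.u X)) rfl

/-- The inverse of the unit at an object of `P`. -/
noncomputable def uInv {Y : B} (hY : P Y) : R.obj Y ⟶ Y :=
  haveI := R.isIso_u hY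
  inv (R.u Y)

lemma u_uInv {Y : B} (hY : P Y) : R.u Y ≫ R.uInv hY = 𝟙 Y :=
  haveI := R.isIso_u hY
  IsIso.hom_inv_id _

lemma map_eHomWhiskerLeft_uInv {X Y : B} (hX : P X) (hY : P Y) :
    R.map X Y ≫ eHomWhiskerLeft V (R.obj X) (R.uInv hY) =
      eHomWhiskerRight V (R.uInv hX) Y := by
  have := R.isIso X Y hY
  rw [← cancel_mono (eHomWhiskerRight V (R.u X) Y), Category.assoc, eHom_whisker_exchange,
    reassoc_of% R.map_eHomWhiskerRight, ← eHomWhiskerLeft_comp, ← eHomWhiskerRight_comp,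
    u_uInv, u_uInv, eHomWhiskerLeft_id, eHomWhiskerRight_id]

/-- The reflector is left adjoint to the inclusion. -/
noncomputable def adjunction : VAdjunction R.functor (fullInclusion P) where
  unit :=
    { app := R.u
      naturality X Y := by
        refine (Category.id_comp _).trans ((R.map_eHomWhiskerRight X Y).symm.trans ?_)
        exact congrArg (· ≫ _) (Category.comp_id (R.map X Y)).symm }
  counit :=
    { app Y := ObjectProperty.homMk (R.uInv Y.property)
      naturality X Y := by
        refine Eq.trans ?_ ((R.map_eHomWhiskerLeft_uInv X.property Y.property).trans
          (Category.id_comp _).symm)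
        exact congrArg (· ≫ _) (Category.id_comp (R.map X.obj Y.obj)) }
  left_triangle X := ObjectProperty.hom_ext _
    ((congrArg (· ≫ R.uInv (R.prop X)) (R.mapHom_u X)).trans (R.u_uInv (R.prop X)))
  right_triangle Y :=
    (congrArg (R.u Y.obj ≫ ·) (homMap_fullInclusion P _)).trans (R.u_uInv Y.property)

end Reflection

end Functors

/-! ### Orthogonality and closure properties of strong monos. -/

section Orthogonality

variable {V : Type u} [Category.{v} V] [MonoidalCategory V]
variable {B : Type u₁} [Category.{v₁} B] [EnrichedOrdinaryCategory V B]

/-- As `m` is a `V`-mono, compatibility with `q` and uniqueness of the lift are automatic. -/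
lemma vOrthogonal_of_vMono {A₁ A₂ X Y : B} (e : A₁ ⟶ A₂) {m : X ⟶ Y} (hm : vMono V B m)
    (h : ∀ ⦃t : V⦄ (p : t ⟶ (A₂ ⟶[V] Y)) (q : t ⟶ (A₁ ⟶[V] X)),
      p ≫ eHomWhiskerRight V e Y = q ≫ eHomWhiskerLeft V A₁ m →
        ∃ l : t ⟶ (A₂ ⟶[V] X), l ≫ eHomWhiskerLeft V A₂ m = p) :
    VOrthogonal V e m := by
  have := hm A₁
  have := hm A₂
  refine ⟨⟨eHom_whisker_exchange V e m⟩, ⟨PullbackCone.IsLimit.mk _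
    (fun s => (h s.fst s.snd s.condition).choose)
    (fun s => (h s.fst s.snd s.condition).choose_spec) (fun s => ?_) (fun s l h₁ _ => ?_)⟩⟩
  · rw [← cancel_mono (eHomWhiskerLeft V A₁ m), Category.assoc, ← eHom_whisker_exchange,
      reassoc_of% (h s.fst s.snd s.condition).choose_spec, s.condition]
  · rw [← cancel_mono (eHomWhiskerLeft V A₂ m), (h s.fst s.snd s.condition).choose_spec, h₁]

lemma VOrthogonal.comp {A₁ A₂ X Y Z : B} {e : A₁ ⟶ A₂} {m : X ⟶ Y} {n : Y ⟶ Z}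
    (hm : VOrthogonal V e m) (hn : VOrthogonal V e n) : VOrthogonal V e (m ≫ n) := by
  have := IsPullback.paste_horiz hm hn
  rwa [← eHomWhiskerLeft_comp, ← eHomWhiskerLeft_comp] at this

/-- `B(e, X)` is a base change of `B(e, Y)`. This makes subobjects of orthogonal objects orthogonal.
-/
lemma VOrthogonal.isIso {A₁ A₂ X Y : B} {e : A₁ ⟶ A₂} {m : X ⟶ Y}
    (hm : VOrthogonal V e m) [IsIso (eHomWhiskerRight V e Y)] :
    IsIso (eHomWhiskerRight V e X) :=
  hm.isIso_snd_of_isIso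

lemma vOrthogonal_of_isIso {A₁ A₂ X Y : B} (e : A₁ ⟶ A₂) (m : X ⟶ Y) [IsIso m] :
    VOrthogonal V e m :=
  IsPullback.of_horiz_isIso ⟨eHom_whisker_exchange V e m⟩

variable (V) in
/-- The class of `V`-monos that are `V`-orthogonal to `W`. -/
def vStrongMonoFor (W : MorphismProperty B) : MorphismProperty B :=
  vRightOrth V W ⊓ vMono V B

lemma vStrongMonoFor_comp {W : MorphismProperty B} {X Y Z : B} {m : X ⟶ Y} {n : Y ⟶ Z}
    (hm : vStrongMonoFor V W m) (hn : vStrongMonoFor V W n) : vStrongMonoFor V W (m ≫ n) :=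
  ⟨fun _ _ e he => (hm.1 e he).comp (hn.1 e he), fun A => by
    have := hm.2 A
    have := hn.2 A
    rw [eHomWhiskerLeft_comp]
    infer_instance⟩

lemma vStrongMonoFor_of_isIso (W : MorphismProperty B) {X Y : B} (m : X ⟶ Y) [IsIso m] :
    vStrongMonoFor V W m :=
  ⟨fun _ _ e _ => vOrthogonal_of_isIso e m, fun _ => inferInstance⟩

/-- `V`-equalizers of morphisms with codomain `Y` are `V`-orthogonal to morphisms `e` that are
`V`-epic with respect to `Y`. -/
lemma exists_vEqualizer {X Y : B} (f g : X ⟶ Y)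
    [Enriched.HasConicalLimit V (parallelPair f g)] (W : MorphismProperty B)
    (hW : ∀ ⦃A₁ A₂ : B⦄ (e : A₁ ⟶ A₂), W e → Mono (eHomWhiskerRight V e Y)) :
    ∃ (E : B) (k : E ⟶ X), k ≫ f = k ≫ g ∧ vStrongMonoFor V W k ∧
      ∀ {Z : B} (u : Z ⟶ X), u ≫ f = u ≫ g → ∃ l, l ≫ k = u := by
  let k := equalizer.ι f g
  have lim (D : B) := isLimitForkMapOfIsLimit (eCoyoneda V D) (equalizer.condition f g)
    (equalizerIsEqualizer f g)
  have mono : vMono V B k := fun D => ⟨fun a b h => Fork.IsLimit.hom_ext (lim D) h⟩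
  refine ⟨_, k, equalizer.condition f g, ⟨fun A₁ A₂ e he => ?_, mono⟩,
    fun u hu => ⟨equalizer.lift u hu, equalizer.lift_ι u hu⟩⟩
  refine vOrthogonal_of_vMono e mono fun t p q hpq => ?_
  have := hW e he
  have w : p ≫ eHomWhiskerLeft V A₂ f = p ≫ eHomWhiskerLeft V A₂ g := by
    rw [← cancel_mono (eHomWhiskerRight V e Y)]
    simp only [Category.assoc, eHom_whisker_exchange, reassoc_of% hpq, ← eHomWhiskerLeft_comp]
    rw [equalizer.condition f g]
  exact ⟨Fork.IsLimit.lift (lim A₂) p w, Fork.IsLimit.lift_ι (lim A₂)⟩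

lemma exists_vFiberProduct {A : B} {ι : Type*} {X : ι → B} (m : ∀ i, X i ⟶ A)
    [Enriched.HasConicalLimit V (WidePullbackShape.wideCospan A X m)] (W : MorphismProperty B)
    (hm : ∀ i, vStrongMonoFor V W (m i)) :
    ∃ (P : B) (k : P ⟶ A) (π : ∀ i, P ⟶ X i), (∀ i, π i ≫ m i = k) ∧ vStrongMonoFor V W k ∧
      ∀ {Z : B} (u : Z ⟶ A), (∀ i, ∃ q, q ≫ m i = u) → ∃ l, l ≫ k = u := by
  let F := WidePullbackShape.wideCospan A X m
  let k : limit F ⟶ A := limit.π F none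
  let π (i : ι) : limit F ⟶ X i := limit.π F (some i)
  have hπ (i : ι) : π i ≫ m i = k := limit.w F (WidePullbackShape.Hom.term i)
  have lim (D : B) := isLimitOfPreserves (eCoyoneda V D) (limit.isLimit F)
  have mono : vMono V B k := fun D => ⟨fun {t} a b h => (lim D).hom_ext fun j => by
    match j with
    | none => exact h
    | some i =>
      have := (hm i).2 D
      refine (cancel_mono (eHomWhiskerLeft V D (m i))).1 ?_
      refine (Category.assoc _ _ _).trans (Eq.trans ?_ (Category.assoc _ _ _).symm)
      have e : eHomWhiskerLeft V D (π i) ≫ eHomWhiskerLeft V D (m i) =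
        eHomWhiskerLeft V D k := by rw [← eHomWhiskerLeft_comp, hπ]
      exact (congrArg (a ≫ ·) e).trans (h.trans (congrArg (b ≫ ·) e.symm))⟩
  refine ⟨_, k, π, hπ, ⟨fun A₁ A₂ e he => vOrthogonal_of_vMono e mono fun t p q hpq => ?_, mono⟩,
    fun u hu => ⟨limit.lift F (WidePullbackShape.mkCone (F := F) u (fun i => (hu i).choose)
      fun i => (hu i).choose_spec), limit.lift_π _ _⟩⟩
  -- Each `m i` is orthogonal to `e`, so `p` lifts along each one separately; the limit assembles
  -- these lifts.
  have hl (i : ι) : ∃ l : t ⟶ (A₂ ⟶[V] X i), l ≫ eHomWhiskerLeft V A₂ (m i) = p := by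
    refine ⟨((hm i).1 e he).lift p (q ≫ eHomWhiskerLeft V A₁ (π i)) ?_,
      ((hm i).1 e he).lift_fst _ _ _⟩
    rw [hpq, Category.assoc, ← eHomWhiskerLeft_comp, hπ]
  exact ⟨(lim A₂).lift (WidePullbackShape.mkCone (F := F ⋙ eCoyoneda V A₂) p
    (fun i => (hl i).choose) fun i => (hl i).choose_spec), (lim A₂).fac _ none⟩

/-- A `V`-epi which is a split mono is an isomorphism. -/
lemma vEpi.isIso {X Y : B} {e : X ⟶ Y} (he : vEpi V B e) [IsSplitMono e] : IsIso e :=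
  haveI := he.epi
  isIso_of_epi_of_isSplitMono e

/-! ### The unit and the reflection. -/

variable {C : Type u₂} [Category.{v₂} C] [EnrichedOrdinaryCategory V C]
variable {S : EnrichedFunctor V B C} {T : EnrichedFunctor V C B}

/-- The left adjoint is conservative on the objects orthogonal to the morphisms it inverts. -/
lemma isIso_of_inverted {X Y : B} (hX : vOrthogonalObjects V (inverted S) X)
    (hY : vOrthogonalObjects V (inverted S) Y) (f : X ⟶ Y) (hf : inverted S f) : IsIso f := by
  have := hX f hf
  have := hY f hf
  obtain ⟨r, hr, -⟩ := existsUnique_comp_eq (V := V) f (𝟙 X)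
  refine ⟨r, hr, (existsUnique_comp_eq (V := V) f f).unique ?_ ?_⟩
  · rw [reassoc_of% hr]
  · rw [Category.comp_id]

/-- The unit of the adjunction is a `V`-strong mono at the objects orthogonal to the morphisms
inverted by the left adjoint. -/
lemma VAdjunction.vStrongMono_η (adj : VAdjunction S T)
    (hfact : IsVFactorizationSystem V (vEpi V B) (vStrongMono V B))
    {X : B} (hX : vOrthogonalObjects V (inverted S) X) : vStrongMono V B (adj.η X) := by
  obtain ⟨Z, e, m, he, hm, h⟩ := hfact.exists_factorization (adj.η X)
  have := he.epi
  have hSe : inverted S e := adj.isIso_homMap e m h fun _ _ _ w => (cancel_epi e).1 w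
  have := hX e hSe
  obtain ⟨r, hr, -⟩ := existsUnique_comp_eq (V := V) e (𝟙 X)
  have : IsSplitMono e := ⟨⟨⟨r, hr⟩⟩⟩
  have := he.isIso
  rw [← h]
  exact vStrongMonoFor_comp (vStrongMonoFor_of_isIso _ e) hm

/-- The reflection of an object is the intersection of all the subobjects of `T (S A)`, given by
`V`-strong monos orthogonal to the morphisms inverted by `S`, through which the unit factors. -/
lemma VAdjunction.exists_reflection (adj : VAdjunction S T) (heq : HasVEqualizers V B)
    (hfib : HasVFiberProductsOf V (vStrongMono V B)) (A : B) :
    ∃ (R : B) (u : A ⟶ R), vOrthogonalObjects V (inverted S) R ∧ inverted S u := by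
  -- Orthogonality to `V`-epis makes the subobjects `V`-strong, so that `hfib` applies;
  -- orthogonality to inverted morphisms keeps their domains orthogonal objects.
  let W : MorphismProperty B := vEpi V B ⊔ inverted S
  have hW {X Y : B} {m : X ⟶ Y} (hm : vStrongMonoFor V W m) : vStrongMono V B m :=
    ⟨fun _ _ e he => hm.1 e (Or.inl he), hm.2⟩
  have mem_of (X : B) {Y : B} (m : X ⟶ Y) (hm : vStrongMonoFor V W m)
      (hY : vOrthogonalObjects V (inverted S) Y) : vOrthogonalObjects V (inverted S) X := by
    intro A₁ A₂ f hf
    have := hY f hf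
    exact (hm.1 f (Or.inr hf)).isIso
  let Q := T.obj (S.obj A)
  have hQ (Y : C) : vOrthogonalObjects V (inverted S) (T.obj Y) := adj.obj_mem_vOrthogonalObjects Y
  -- This type lives in `Type (max u₁ v₁)`, the size allowed by `HasVFiberProductsOf`.
  let ι := Σ X : B, { m : X ⟶ Q // vStrongMonoFor V W m ∧ ∃ q, q ≫ m = adj.η A }
  have := hfib Q ι (fun i => i.1) (fun i => i.2.1) (fun i => hW i.2.2.1)
  obtain ⟨R, k, π, hπ, hk, hlift⟩ := exists_vFiberProduct (V := V)
    (fun i : ι => i.2.1) W (fun i => i.2.2.1)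
  obtain ⟨u, hu⟩ := hlift (adj.η A) (fun i => i.2.2.2)
  refine ⟨R, u, mem_of R k hk (hQ _), adj.isIso_homMap u k hu fun Y g h w => ?_⟩
  have := heq g h
  obtain ⟨E, j, hj, hjW, hjlift⟩ := exists_vEqualizer (V := V) g h W fun A₁ A₂ e he => by
    obtain he | he := he
    · exact he _
    · have := hQ Y e he
      infer_instance
  obtain ⟨l, hl⟩ := hjlift u w
  -- The equalizer belongs to the family being intersected, so the projection `π i` splits `j`,
  -- which forces `g = h`.
  let i : ι := ⟨E, j ≫ k, vStrongMonoFor_comp hjW hk, l, by rw [reassoc_of% hl, hu]⟩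
  have := hk.2.mono
  have hi : π i ≫ j = 𝟙 R := by
    rw [← cancel_mono k, Category.assoc, Category.id_comp]
    exact hπ i
  rw [← Category.id_comp g, ← Category.id_comp h, ← hi, Category.assoc, hj, Category.assoc]

end Orthogonality

end EnrichedAdjFactorization

open EnrichedAdjFactorization in
theorem mainTheorem3
    (V : Type u) [Category.{v} V] [MonoidalCategory V] [SymmetricCategory V] [MonoidalClosed V]
    (B : Type u₁) [Category.{v₁} B] [EnrichedOrdinaryCategory V B]
    (C : Type u₂) [Category.{v₂} C] [EnrichedOrdinaryCategory V C]
    (S : EnrichedFunctor V B C) (T : EnrichedFunctor V C B) (adj : VAdjunction S T)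
    (hfact : IsVFactorizationSystem V (vEpi V B) (vStrongMono V B))
    (hproper : IsVProper V (vEpi V B) (vStrongMono V B))
    (hcot : IsCotensored V B)
    (heq : HasVEqualizers V B)
    (hpb : HasVPullbacksOf V (vStrongMono V B))
    (hfib : HasVFiberProductsOf V (vStrongMono V B)) :
    ∃ (P : ObjectProperty B)
      (K : EnrichedFunctor V B P.FullSubcategory)
      (S'' : EnrichedFunctor V P.FullSubcategory C)
      (T'' : EnrichedFunctor V C P.FullSubcategory)
      (adj'' : VAdjunction S'' T''),
      Nonempty (VAdjunction K (fullInclusion P)) ∧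
      T''.comp V (fullInclusion P) = T ∧
      S'' = (fullInclusion P).comp V S ∧
      (underlying S'').ReflectsIsomorphisms ∧
      (∀ X : P.FullSubcategory,
        vStrongMono V B (P.ι.map (adj''.unit.app X))) ∧
      P = vOrthogonalObjects V (inverted S) := by 
  choose R u hR hu using adj.exists_reflection heq hfib
  let P := vOrthogonalObjects V (inverted S)
  let refl : Reflection V P :=
    { obj := R
      prop := hR
      u := u
      isIso := fun X _ hY => hY (u X) (hu X) }
  refine ⟨P, refl.functor, (fullInclusion P).comp V S,
    liftFull P T adj.obj_mem_vOrthogonalObjects,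
    adj.restrict P adj.obj_mem_vOrthogonalObjects, ⟨refl.adjunction⟩,
    liftFull_comp_fullInclusion P T _, rfl, ⟨fun {X Y} f hf => ?_⟩,
    fun X => adj.vStrongMono_η hfact X.property, rfl⟩
  have hf' : IsIso (homMap ((fullInclusion P).comp V S) f) := hf
  rw [homMap_fullInclusion_comp] at hf'
  have : IsIso (P.ι.map f) := isIso_of_inverted X.property Y.property f.hom hf'
  exact isIso_of_reflects_iso f P.ι
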